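/- Let $\alpha\in(0,1)$ be irrational with regular continued fraction $\alpha=1/(a_1+1/(a_2+1/(a_3+\cdots)))$. Define $p_1=0$, $p_2=1$, $q_1=1$, $q_2=a_1$ and, for $n\ge2$, $p_{n+1}=a_np_n+p_{n-1}$, $q_{n+1}=a_nq_n+q_{n-1}$. For $n\ge1$ put $\alpha_n=|q_n\alpha-p_n|$, and let $\mathcal V_\alpha$ be the set of all $x\in(0,1)$ for which there is exactly one sequence $(x_1,x_2,\dots)\in\prod_{n\ge1}\{0,1,\dots,a_n\}$ with $x=\sum_{n=1}^\infty x_n\alpha_n$. Put $n_0=\sup\{n\ge1:a_n=1\}$ (with $n_0=0$ if no $a_n$ equals $1$). Suppose that there is a constant $C$ with $a_n\le C$ for all $n\ge1$, and that $n_0<\infty$, i.e. only finitely many $a_n$ equal $1$. Then the Hausdorff dimension of $\mathcal V_\alpha$ is positive if and only if $$\Delta=\limsup_{n\to\infty}\frac1n\#\{1\le k\le n: a_k=2\}<1 .$$ -/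

import Mathlib

open Filter Set

namespace RotationalExpansion

/-- The `n`-th partial quotient `a n` (for `n ≥ 1`) of the regular continued fraction
`α = 1 / (a 1 + 1 / (a 2 + ⋯))` of an irrational `α ∈ (0,1)`, as a natural number.
Mathlib numbers the partial denominators from `0`. -/
noncomputable def partialQuotient (α : ℝ) (n : ℕ) : ℕ :=
  ⌊((GenContFract.of α).partDens.get? (n - 1)).getD 0⌋₊

/-- The numerator `p n` (for `n ≥ 1`) of the `n`-th convergent, numbered so that
`p 1 = 0`, `p 2 = 1`, `p (n + 1) = a n * p n + p (n - 1)`. -/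
noncomputable def convergentNum (α : ℝ) (n : ℕ) : ℝ :=
  (GenContFract.of α).nums (n - 1)

/-- The denominator `q n` (for `n ≥ 1`) of the `n`-th convergent, numbered so that
`q 1 = 1`, `q 2 = a 1`, `q (n + 1) = a n * q n + q (n - 1)`. -/
noncomputable def convergentDen (α : ℝ) (n : ℕ) : ℝ :=
  (GenContFract.of α).dens (n - 1)

/-- The base of the expansion: `α_n = |q n * α - p n|` for `n ≥ 1` (so `α_1 = α`). -/
noncomputable def base (α : ℝ) (n : ℕ) : ℝ :=
  |convergentDen α n * α - convergentNum α n|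

/-- `x 0, x 1, …` lists the digits at the places `1, 2, …` of an element of
`Z_α = ∏_{n ≥ 1} {0, 1, …, a n}` whose value `∑_{n ≥ 1} x_n α_n` is `t`. -/
def IsExpansion (α : ℝ) (x : ℕ → ℕ) (t : ℝ) : Prop :=
  (∀ n, x n ≤ partialQuotient α (n + 1)) ∧
    HasSum (fun n => (x n : ℝ) * base α (n + 1)) t

/-- The set `V_α` of all `t ∈ (0,1)` with exactly one expansion with digits in `Z_α`. -/
def uniqueSet (α : ℝ) : Set ℝ :=
  {t | t ∈ Ioo (0 : ℝ) 1 ∧ ∃! x : ℕ → ℕ, IsExpansion α x t}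

/-- `n₀ = sup {n ≥ 1 : a n = 1}`, in `ℕ ∪ {∞}` (with value `0` if no `a n` is `1`). -/
noncomputable def lastOne (α : ℝ) : ℕ∞ :=
  ⨆ n ∈ {n : ℕ | 1 ≤ n ∧ partialQuotient α n = 1}, (n : ℕ∞)

/-- `(1 / n) * #{1 ≤ k ≤ n : a k = 2}`. -/
noncomputable def twoFrequency (α : ℝ) (n : ℕ) : ℝ :=
  (((Finset.Icc 1 n).filter (fun k => partialQuotient α k = 2)).card : ℝ) / n

end RotationalExpansion

namespace RotationalExpansion

/-- A sequence of positive weights `b` with `b n = A n * b (n + 1) + b (n + 2)`, where `A n ≥ 1`. -/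
structure IsWeight (A : ℕ → ℕ) (b : ℕ → ℝ) : Prop where
  pos : ∀ n, 0 < b n
  one_le : ∀ n, 1 ≤ A n
  eq_add : ∀ n, b n = A n * b (n + 1) + b (n + 2)

/-- The orbit of `α` under the Gauss map. -/
noncomputable def gaussOrbit (α : ℝ) : ℕ → ℝ
  | 0 => α
  | n + 1 => Int.fract (gaussOrbit α n)⁻¹

/-- The products `∏ k < n, gaussOrbit α k`. -/
noncomputable def weight (α : ℝ) (n : ℕ) : ℝ := ∏ k ∈ Finset.range n, gaussOrbit α k

section ContFract

variable {α : ℝ}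

theorem irrational_gaussOrbit (hirr : Irrational α) (n : ℕ) : Irrational (gaussOrbit α n) := by
  induction n with
  | zero => exact hirr
  | succ n ih =>
    have h := ih.inv
    rw [← Int.floor_add_fract (gaussOrbit α n)⁻¹] at h
    exact h.of_intCast_add _

theorem gaussOrbit_mem (hα : α ∈ Ioo (0 : ℝ) 1) (hirr : Irrational α) (n : ℕ) :
    gaussOrbit α n ∈ Ioo (0 : ℝ) 1 := by
  cases n with
  | zero => exact hα
  | succ n =>
    exact ⟨(Int.fract_nonneg _).lt_of_ne' (irrational_gaussOrbit hirr (n + 1)).ne_zero,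
      Int.fract_lt_one _⟩

theorem stream_eq (hα : α ∈ Ioo (0 : ℝ) 1) (hirr : Irrational α) (n : ℕ) :
    ∃ p, GenContFract.IntFractPair.stream α n = some p ∧ p.fr = gaussOrbit α n := by
  induction n with
  | zero =>
    refine ⟨_, GenContFract.IntFractPair.stream_zero α, ?_⟩
    exact Int.fract_eq_self.2 ⟨hα.1.le, hα.2⟩
  | succ n ih =>
    obtain ⟨p, hp, hfr⟩ := ih
    refine ⟨_, GenContFract.IntFractPair.stream_succ_of_some hp ?_, ?_⟩
    · rw [hfr]
      exact (irrational_gaussOrbit hirr n).ne_zero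
    · rw [hfr]
      rfl

theorem get?_of_eq (hα : α ∈ Ioo (0 : ℝ) 1) (hirr : Irrational α) (n : ℕ) :
    (GenContFract.of α).s.get? n = some ⟨1, (⌊(gaussOrbit α n)⁻¹⌋ : ℝ)⟩ := by
  obtain ⟨p, hp, hfr⟩ := stream_eq hα hirr n
  have h := GenContFract.IntFractPair.stream_succ_of_some hp
    (by rw [hfr]; exact (irrational_gaussOrbit hirr n).ne_zero)
  rw [GenContFract.get?_of_eq_some_of_succ_get?_intFractPair_stream h, hfr]
  rfl

theorem one_le_inv_gaussOrbit (hα : α ∈ Ioo (0 : ℝ) 1) (hirr : Irrational α) (n : ℕ) :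
    1 ≤ (gaussOrbit α n)⁻¹ := by
  have h := gaussOrbit_mem hα hirr n
  exact (one_le_inv₀ h.1).2 h.2.le

theorem partialQuotient_succ (hα : α ∈ Ioo (0 : ℝ) 1) (hirr : Irrational α) (n : ℕ) :
    partialQuotient α (n + 1) = ⌊(gaussOrbit α n)⁻¹⌋₊ := by
  have h : (GenContFract.of α).partDens.get? n = some (⌊(gaussOrbit α n)⁻¹⌋ : ℝ) := by
    simp [GenContFract.partDens, get?_of_eq hα hirr n]
  rw [partialQuotient, Nat.add_sub_cancel, h, Option.getD_some, ← Int.floor_toNat,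
    Int.floor_intCast, Int.floor_toNat]

theorem cast_partialQuotient_succ (hα : α ∈ Ioo (0 : ℝ) 1) (hirr : Irrational α) (n : ℕ) :
    (partialQuotient α (n + 1) : ℝ) = ⌊(gaussOrbit α n)⁻¹⌋ := by
  rw [partialQuotient_succ hα hirr]
  exact natCast_floor_eq_intCast_floor (by linarith [one_le_inv_gaussOrbit hα hirr n])

theorem isWeight_weight (hα : α ∈ Ioo (0 : ℝ) 1) (hirr : Irrational α) :
    IsWeight (fun n => partialQuotient α (n + 1)) (weight α) where
  pos n := Finset.prod_pos fun k _ => (gaussOrbit_mem hα hirr k).1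
  one_le n := by
    rw [partialQuotient_succ hα hirr]
    exact Nat.one_le_floor_iff _ |>.2 (one_le_inv_gaussOrbit hα hirr n)
  eq_add n := by
    have h := (gaussOrbit_mem hα hirr n).1.ne'
    have h1 : weight α (n + 1) = weight α n * gaussOrbit α n := Finset.prod_range_succ _ _
    have h2 : weight α (n + 2) = weight α (n + 1) * gaussOrbit α (n + 1) :=
      Finset.prod_range_succ _ _
    have h3 := Int.floor_add_fract (gaussOrbit α n)⁻¹
    rw [cast_partialQuotient_succ hα hirr, h2, gaussOrbit, h1]
    calc weight α n
        = weight α n * gaussOrbit α n * (⌊(gaussOrbit α n)⁻¹⌋ + Int.fract (gaussOrbit α n)⁻¹) := by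
          rw [h3]; field_simp
      _ = _ := by ring

theorem dens_mul_sub_nums (hα : α ∈ Ioo (0 : ℝ) 1) (hirr : Irrational α) (n : ℕ) :
    (GenContFract.of α).dens n * α - (GenContFract.of α).nums n = (-1) ^ n * weight α (n + 1) := by
  have hfl : ⌊α⌋ = 0 := Int.floor_eq_zero_iff.2 ⟨hα.1.le, hα.2⟩
  have hw := isWeight_weight hα hirr
  have h1 : weight α 1 = α := by simp [weight, gaussOrbit]
  induction n using Nat.twoStepInduction with
  | zero => simp [GenContFract.of_h_eq_floor, hfl, h1]
  | one =>
    have h0 : weight α 0 = 1 := by simp [weight]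
    have h := hw.eq_add 0
    rw [cast_partialQuotient_succ hα hirr, h0] at h
    simp only [zero_add, h1] at h
    rw [GenContFract.first_num_eq (get?_of_eq hα hirr 0),
      GenContFract.first_den_eq (get?_of_eq hα hirr 0)]
    simp only [GenContFract.of_h_eq_floor, hfl]
    norm_num
    linarith
  | more n ih ih' =>
    rw [GenContFract.dens_recurrence (get?_of_eq hα hirr (n + 1)) rfl rfl,
      GenContFract.nums_recurrence (get?_of_eq hα hirr (n + 1)) rfl rfl]
    have h := hw.eq_add (n + 1)
    rw [cast_partialQuotient_succ hα hirr] at h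
    linear_combination ih + (⌊(gaussOrbit α (n + 1))⁻¹⌋ : ℝ) * ih' + (-1) ^ n * h

theorem base_succ (hα : α ∈ Ioo (0 : ℝ) 1) (hirr : Irrational α) (n : ℕ) :
    base α (n + 1) = weight α (n + 1) := by
  simp only [base, convergentDen, convergentNum, Nat.add_sub_cancel]
  rw [dens_mul_sub_nums hα hirr, abs_mul, abs_pow, abs_neg, abs_one, one_pow, one_mul,
    abs_of_pos ((isWeight_weight hα hirr).pos _)]

end ContFract

namespace IsWeight

variable {A : ℕ → ℕ} {b : ℕ → ℝ}

theorem shift (h : IsWeight A b) (N : ℕ) :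
    IsWeight (fun n => A (N + n)) (fun n => b (N + n)) where
  pos _ := h.pos _
  one_le _ := h.one_le _
  eq_add _ := h.eq_add _

theorem add_le (h : IsWeight A b) (n : ℕ) : b (n + 1) + b (n + 2) ≤ b n := by
  have h1 : (1 : ℝ) ≤ A n := by exact_mod_cast h.one_le n
  nlinarith [h.eq_add n, h.pos (n + 1)]

theorem succ_lt (h : IsWeight A b) (n : ℕ) : b (n + 1) < b n := by
  linarith [h.add_le n, h.pos (n + 2)]

theorem sq_le (h : IsWeight A b) (h0 : b 0 = 1) (n : ℕ) : b n ^ 2 ≤ 4 * (1 / 2) ^ n := by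
  suffices b n ≤ 1 ∧ b n ^ 2 ≤ 2 * (1 / 2) ^ n ∧ b (n + 1) ^ 2 ≤ 2 * (1 / 2) ^ (n + 1) from
    this.2.1.trans (by linarith [show (0 : ℝ) < (1 / 2) ^ n by positivity])
  induction n with
  | zero =>
    have h1 := h.succ_lt 0
    have h2 := h.pos 1
    simp only [zero_add, h0] at *
    exact ⟨le_rfl, by norm_num, by rw [pow_one]; nlinarith⟩
  | succ n ih =>
    refine ⟨(h.succ_lt n).le.trans ih.1, ih.2.2, ?_⟩
    have h1 := h.add_le n
    have h2 := h.succ_lt (n + 1)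
    have h3 := h.pos (n + 2)
    have h4 : 2 * b (n + 2) ≤ b n := by linarith
    have h5 : (2 * b (n + 2)) ^ 2 ≤ b n ^ 2 := by gcongr
    have h6 := ih.2.1
    have h7 : (1 / 2 : ℝ) ^ (n + 1 + 1) = (1 / 2) ^ n / 4 := by ring
    rw [h7, show n + 1 + 1 = n + 2 from rfl]
    linarith

theorem tendsto_zero (h : IsWeight A b) (h0 : b 0 = 1) : Tendsto b atTop (nhds 0) := by
  have h1 : Tendsto (fun n => b n ^ 2) atTop (nhds 0) := by
    refine squeeze_zero (fun n => sq_nonneg _) (h.sq_le h0) ?_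
    simpa using (tendsto_pow_atTop_nhds_zero_of_lt_one (r := (1 / 2 : ℝ)) (by norm_num)
      (by norm_num)).const_mul 4
  have h2 := h1.sqrt
  simp only [Real.sqrt_zero] at h2
  exact h2.congr fun n => Real.sqrt_sq (h.pos n).le

theorem tendsto_shift (h : IsWeight A b) (h0 : b 0 = 1) (N : ℕ) :
    Tendsto (fun n => b (N + n)) atTop (nhds 0) := by
  simpa only [add_comm] using (tendsto_add_atTop_iff_nat N).2 (h.tendsto_zero h0)

theorem inv_pow_le (h : IsWeight A b) (h0 : b 0 = 1) {C : ℕ} (hC : ∀ n, A n ≤ C) (n : ℕ) :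
    ((C + 1 : ℝ) ^ n)⁻¹ ≤ b n := by
  induction n with
  | zero => simp [h0]
  | succ n ih =>
    have h1 : (A n : ℝ) ≤ C := by exact_mod_cast hC n
    have h2 : b n ≤ (C + 1) * b (n + 1) := by
      nlinarith [h.eq_add n, h.succ_lt (n + 1), h.pos (n + 1)]
    have h3 : (0 : ℝ) < C + 1 := by positivity
    rw [pow_succ, mul_inv, ← div_eq_mul_inv, div_le_iff₀ h3]
    linarith

theorem hasSum_max (h : IsWeight A b) (hb : Tendsto b atTop (nhds 0)) :
    HasSum (fun n => (A n : ℝ) * b (n + 1)) (b 0 + b 1) := by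
  rw [hasSum_iff_tendsto_nat_of_nonneg fun n => mul_nonneg (Nat.cast_nonneg _) (h.pos _).le]
  have h1 : ∀ n, ∑ i ∈ Finset.range n, (A i : ℝ) * b (i + 1) = b 0 + b 1 - (b n + b (n + 1)) := by
    intro n
    induction n with
    | zero => simp
    | succ n ih => rw [Finset.sum_range_succ, ih]; linarith [h.eq_add n]
  simp only [h1]
  simpa using (tendsto_const_nhds (x := b 0 + b 1)).sub
    (hb.add ((tendsto_add_atTop_iff_nat 1).2 hb))

/-- Every number in `[0, b 0 + b 1]` has an expansion, found by the greedy algorithm. -/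
theorem exists_hasSum (h : IsWeight A b) (hb : Tendsto b atTop (nhds 0)) {r : ℝ}
    (hr : r ∈ Icc 0 (b 0 + b 1)) :
    ∃ x : ℕ → ℕ, (∀ n, x n ≤ A n) ∧ HasSum (fun n => (x n : ℝ) * b (n + 1)) r := by
  let d : ℕ → ℝ → ℕ := fun n s => min (A n) ⌊s / b (n + 1)⌋₊
  let ρ : ℕ → ℝ := fun n => Nat.rec r (fun n s => s - d n s * b (n + 1)) n
  have hρ : ∀ n, ρ (n + 1) = ρ n - d n (ρ n) * b (n + 1) := fun n => rfl
  have hmem : ∀ n, ρ n ∈ Icc 0 (b n + b (n + 1)) := by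
    intro n
    induction n with
    | zero => exact hr
    | succ n ih =>
      have hp := h.pos (n + 1)
      have hp2 := h.pos (n + 2)
      have hq : 0 ≤ ρ n / b (n + 1) := div_nonneg ih.1 hp.le
      rw [hρ]
      constructor
      · have : (d n (ρ n) : ℝ) ≤ ρ n / b (n + 1) :=
          le_trans (by exact_mod_cast min_le_right _ _) (Nat.floor_le hq)
        rw [le_div_iff₀ hp] at this
        linarith
      · rcases min_choice (A n) ⌊ρ n / b (n + 1)⌋₊ with hd | hd
        · simp only [d, hd]
          linarith [ih.2, h.eq_add n]
        · have := Nat.lt_floor_add_one (ρ n / b (n + 1))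
          rw [div_lt_iff₀ hp] at this
          simp only [d, hd]
          linarith
  refine ⟨fun n => d n (ρ n), fun n => min_le_left _ _, ?_⟩
  rw [hasSum_iff_tendsto_nat_of_nonneg fun n => mul_nonneg (Nat.cast_nonneg _) (h.pos _).le]
  have h1 : ∀ n, ∑ i ∈ Finset.range n, (d i (ρ i) : ℝ) * b (i + 1) = r - ρ n := by
    intro n
    induction n with
    | zero => simp [ρ]
    | succ n ih => rw [Finset.sum_range_succ, ih, hρ]; ring
  simp only [h1]
  have h2 : Tendsto ρ atTop (nhds 0) := by
    refine squeeze_zero (fun n => (hmem n).1) (fun n => (hmem n).2) ?_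
    simpa using hb.add ((tendsto_add_atTop_iff_nat 1).2 hb)
  simpa using h2.const_sub r

end IsWeight

/-- The contribution `∑ n ≥ N, x n * b (n + 1)` of the digits from place `N` on. -/
noncomputable def tail (b : ℕ → ℝ) (x : ℕ → ℕ) (N : ℕ) : ℝ :=
  ∑' n, (x (N + n) : ℝ) * b (N + n + 1)

/-- The digit sequences that vanish before place `K` and are neither `0` nor maximal from
place `K` on. -/
def interiorDigits (A : ℕ → ℕ) (K : ℕ) : Set (ℕ → ℕ) :=
  {x | (∀ n < K, x n = 0) ∧ (∀ n, x n < A n) ∧ ∀ n, K ≤ n → 1 ≤ x n}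

namespace IsWeight

variable {A : ℕ → ℕ} {b : ℕ → ℝ} {x y : ℕ → ℕ} {K N : ℕ}

theorem summable (h : IsWeight A b) (h0 : b 0 = 1) (hx : ∀ n, x n ≤ A n) :
    Summable fun n => (x n : ℝ) * b (n + 1) :=
  Summable.of_nonneg_of_le (fun n => mul_nonneg (Nat.cast_nonneg _) (h.pos _).le)
    (fun n => mul_le_mul_of_nonneg_right (by exact_mod_cast hx n) (h.pos _).le)
    (h.hasSum_max (h.tendsto_zero h0)).summable

theorem summable_tail (h : IsWeight A b) (h0 : b 0 = 1) (hx : ∀ n, x n ≤ A n) (N : ℕ) :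
    Summable fun n => (x (N + n) : ℝ) * b (N + n + 1) := by
  simpa only [add_comm N] using (summable_nat_add_iff N).2 (h.summable h0 hx)

theorem tail_eq (h : IsWeight A b) (h0 : b 0 = 1) (hx : ∀ n, x n ≤ A n) (N : ℕ) :
    tail b x N = x N * b (N + 1) + tail b x (N + 1) := by
  rw [tail, (h.summable_tail h0 hx N).tsum_eq_zero_add]
  simp only [tail, Nat.add_zero, add_assoc, add_comm 1]

theorem tail_nonneg (h : IsWeight A b) (N : ℕ) : 0 ≤ tail b x N :=
  tsum_nonneg fun _ => mul_nonneg (Nat.cast_nonneg _) (h.pos _).le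

theorem tail_max (h : IsWeight A b) (h0 : b 0 = 1) (N : ℕ) : tail b A N = b N + b (N + 1) :=
  ((h.shift N).hasSum_max (h.tendsto_shift h0 N)).tsum_eq

theorem tail_mono (h : IsWeight A b) (h0 : b 0 = 1) (hy : ∀ n, y n ≤ A n)
    (hxy : ∀ n, N ≤ n → x n ≤ y n) : tail b x N ≤ tail b y N := by
  have hle : ∀ n, (x (N + n) : ℝ) * b (N + n + 1) ≤ y (N + n) * b (N + n + 1) := fun n =>
    mul_le_mul_of_nonneg_right (by exact_mod_cast hxy _ (Nat.le_add_right _ _)) (h.pos _).le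
  exact (Summable.of_nonneg_of_le (fun n => mul_nonneg (Nat.cast_nonneg _) (h.pos _).le) hle
    (h.summable_tail h0 hy N)).tsum_le_tsum hle (h.summable_tail h0 hy N)

theorem tail_le (h : IsWeight A b) (h0 : b 0 = 1) (hx : ∀ n, x n ≤ A n) (N : ℕ) :
    tail b x N ≤ b N + b (N + 1) :=
  (h.tail_mono h0 (fun _ => le_rfl) fun n _ => hx n).trans_eq (h.tail_max h0 N)

theorem lt_tail_of_one_le (h : IsWeight A b) (h0 : b 0 = 1) (hx : ∀ n, x n ≤ A n)
    (h1 : ∀ n, N ≤ n → 1 ≤ x n) : b (N + 1) < tail b x N := by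
  have h2 := h.tail_eq h0 hx N
  have h3 := h.tail_eq h0 hx (N + 1)
  have h4 : (1 : ℝ) ≤ x N := by exact_mod_cast h1 N le_rfl
  have h5 : (1 : ℝ) ≤ x (N + 1) := by exact_mod_cast h1 _ (Nat.le_succ N)
  nlinarith [h.pos (N + 1), h.pos (N + 2), h.tail_nonneg (x := x) (N + 2)]

theorem tail_lt_of_lt (h : IsWeight A b) (h0 : b 0 = 1) (hx : ∀ n, x n < A n) (N : ℕ) :
    tail b x N < b N := by
  have h1 : tail b (fun n => A n - x n) N = tail b A N - tail b x N := by
    rw [tail, tail, tail, ← (h.summable_tail h0 (fun _ => le_rfl) N).tsum_sub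
      (h.summable_tail h0 (fun n => (hx n).le) N)]
    congr 1 with n
    rw [Nat.cast_sub (hx _).le]
    ring
  have h2 := h.lt_tail_of_one_le h0 (N := N) (x := fun n => A n - x n)
    (fun n => Nat.sub_le _ _) (fun n _ => Nat.sub_pos_of_lt (hx n))
  rw [h1, h.tail_max h0] at h2
  linarith

theorem tail_sub_of_eq (h : IsWeight A b) (h0 : b 0 = 1) (hx : ∀ n, x n ≤ A n)
    (hy : ∀ n, y n ≤ A n) (hxy : ∀ k < N, x k = y k) :
    tail b x 0 - tail b y 0 = tail b x N - tail b y N := by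
  induction N with
  | zero => rfl
  | succ N ih =>
    rw [ih fun k hk => hxy k (hk.trans N.lt_succ_self), h.tail_eq h0 hx N, h.tail_eq h0 hy N,
      hxy N N.lt_succ_self]
    ring

theorem hasSum_iff_tail (h : IsWeight A b) (h0 : b 0 = 1) (hx : ∀ n, x n ≤ A n) {t : ℝ} :
    HasSum (fun n => (x n : ℝ) * b (n + 1)) t ↔ tail b x 0 = t := by
  rw [(h.summable h0 hx).hasSum_iff]
  simp only [tail, zero_add]

/-- A digit can be changed if the remaining places can make up for it. -/
theorem exists_ne_of_mem (h : IsWeight A b) (h0 : b 0 = 1) (hx : ∀ n, x n ≤ A n) {d : ℕ}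
    (hd : d ≤ A N) (hne : d ≠ x N)
    (hr : tail b x N - d * b (N + 1) ∈ Icc 0 (b (N + 1) + b (N + 2))) :
    ∃ y : ℕ → ℕ, y ≠ x ∧ (∀ n, y n ≤ A n) ∧ tail b y 0 = tail b x 0 := by
  obtain ⟨z, hz, hzs⟩ := (h.shift (N + 1)).exists_hasSum (h.tendsto_shift h0 (N + 1)) hr
  let y : ℕ → ℕ := fun n => if n < N then x n else if n = N then d else z (n - (N + 1))
  have hy : ∀ n, y n ≤ A n := by
    intro n
    simp only [y]
    split_ifs with h1 h2
    · exact hx n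
    · rw [h2]; exact hd
    · have := hz (n - (N + 1))
      rwa [show N + 1 + (n - (N + 1)) = n by omega] at this
  have hyN : y N = d := by simp [y]
  have hyt : tail b y (N + 1) = tail b x N - d * b (N + 1) := by
    rw [← hzs.tsum_eq, tail]
    congr 1 with n
    have : y (N + 1 + n) = z n := by
      simp only [y]
      rw [if_neg (by omega), if_neg (by omega), Nat.add_sub_cancel_left]
    rw [this]
    rfl
  refine ⟨y, fun he => hne (by rw [← hyN, he]), hy, sub_eq_zero.1 ?_⟩
  rw [h.tail_sub_of_eq h0 hy hx (N := N) fun k hk => by simp [y, hk], h.tail_eq h0 hy N, hyt, hyN]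
  ring

theorem le_tail_sub_tail (h : IsWeight A b) (h0 : b 0 = 1) (hx : ∀ n, x n ≤ A n)
    (hy : ∀ n, y n ≤ A n) (hxy : ∀ k < N, x k = y k) (hlt : y N < x N) :
    b (N + 1) + tail b x (N + 1) - tail b y (N + 1) ≤ tail b x 0 - tail b y 0 := by
  rw [h.tail_sub_of_eq h0 hx hy hxy, h.tail_eq h0 hx N, h.tail_eq h0 hy N]
  have : (y N : ℝ) + 1 ≤ x N := by exact_mod_cast hlt
  nlinarith [h.pos (N + 1)]

/-- An interior digit sequence is determined by its value among all digit sequences. -/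
theorem eq_of_tail_eq (h : IsWeight A b) (h0 : b 0 = 1) (hx : x ∈ interiorDigits A K)
    (hy : ∀ n, y n ≤ A n) (ht : tail b y 0 = tail b x 0) : y = x := by
  obtain ⟨hx0, hxA, hx1⟩ := hx
  have hx' := fun n => (hxA n).le
  ext n
  induction n using Nat.strong_induction_on with
  | _ n ih =>
    rcases lt_trichotomy (y n) (x n) with hlt | heq | hgt
    · have hK : K ≤ n := by
        by_contra hK
        rw [hx0 n (not_le.1 hK)] at hlt
        exact absurd hlt (Nat.not_lt_zero _)
      have h1 := h.le_tail_sub_tail h0 hx' hy (fun k hk => (ih k hk).symm) hlt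
      have h2 := h.lt_tail_of_one_le h0 hx' (N := n + 1) fun k hk => hx1 k (by omega)
      have h3 := h.tail_le h0 hy (n + 1)
      linarith
    · exact heq
    · have h1 := h.le_tail_sub_tail h0 hy hx' ih hgt
      have h2 := h.tail_lt_of_lt h0 hxA (n + 1)
      have h3 := h.tail_nonneg (x := y) (n + 1)
      linarith

/-- Values of interior digit sequences that differ first at place `N` are well separated. -/
theorem lt_abs_tail_sub (h : IsWeight A b) (h0 : b 0 = 1) (hx : x ∈ interiorDigits A K)
    (hy : y ∈ interiorDigits A K) (hxy : ∀ k < N, x k = y k) (hne : x N ≠ y N) :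
    b (N + 2) < |tail b x 0 - tail b y 0| := by
  wlog hlt : y N < x N generalizing x y
  · rw [abs_sub_comm]
    exact this hy hx (fun k hk => (hxy k hk).symm) hne.symm (by omega)
  have hK : K ≤ N := by
    by_contra hK
    rw [hx.1 N (not_le.1 hK)] at hlt
    exact absurd hlt (Nat.not_lt_zero _)
  have h1 := h.le_tail_sub_tail h0 (fun n => (hx.2.1 n).le) (fun n => (hy.2.1 n).le) hxy hlt
  have h2 := h.lt_tail_of_one_le h0 (fun n => (hx.2.1 n).le) (N := N + 1)
    fun k hk => hx.2.2 k (by omega)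
  have h3 := h.tail_lt_of_lt h0 hy.2.1 (N + 1)
  exact lt_of_lt_of_le (by linarith) (le_abs_self _)

end IsWeight

/-- Numbers with a unique expansion are exactly the values of interior digit sequences. -/
theorem mem_uniqueSet_iff {α : ℝ} (hα : α ∈ Ioo (0 : ℝ) 1) (hirr : Irrational α) {t : ℝ} :
    t ∈ uniqueSet α ↔ ∃ K, ∃ x ∈ interiorDigits (fun n => partialQuotient α (n + 1)) K,
      tail (weight α) x 0 = t := by
  have h := isWeight_weight hα hirr
  have h0 : weight α 0 = 1 := by simp [weight]
  set A : ℕ → ℕ := fun n => partialQuotient α (n + 1) with hA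
  have hexp : ∀ x s, IsExpansion α x s ↔ (∀ n, x n ≤ A n) ∧ tail (weight α) x 0 = s := by
    intro x s
    rw [IsExpansion]
    simp only [base_succ hα hirr]
    exact and_congr_right fun hx => h.hasSum_iff_tail h0 hx
  constructor
  · rintro ⟨ht, x, hx, huniq⟩
    simp only [hexp] at hx huniq
    obtain ⟨hxA, hxt⟩ := hx
    have hfix : ∀ N d, d ≤ A N → d ≠ x N → ¬ (tail (weight α) x N - d * weight α (N + 1) ∈
        Icc 0 (weight α (N + 1) + weight α (N + 2))) := by
      intro N d hd hne hr
      obtain ⟨y, hyx, hy, hyt⟩ := h.exists_ne_of_mem h0 hxA hd hne hr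
      exact hyx (huniq y ⟨hy, hyt.trans hxt⟩)
    have htail := h.tail_eq h0 hxA
    have hnn := h.tail_nonneg (b := weight α) (x := x)
    have hle := h.tail_le h0 hxA
    have hup : ∀ N, x N < A N → tail (weight α) x (N + 1) < weight α (N + 1) := by
      intro N hN
      by_contra! hc
      refine hfix N (x N + 1) hN (Nat.succ_ne_self _) ?_
      rw [htail N]
      push_cast
      exact ⟨by linarith, by linarith [hle (N + 1), h.pos (N + 1)]⟩
    have hdown : ∀ N, 1 ≤ x N → weight α (N + 2) < tail (weight α) x (N + 1) := by
      intro N hN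
      by_contra! hc
      refine hfix N (x N - 1) ((Nat.sub_le _ _).trans (hxA N)) (by omega) ?_
      rw [htail N]
      push_cast [hN]
      exact ⟨by linarith [hnn (N + 1), h.pos (N + 1)], by linarith⟩
    have hlt : ∀ N, tail (weight α) x N < weight α N → x N < A N := by
      intro N hN
      refine lt_of_le_of_ne (hxA N) fun he => ?_
      have h1 := hdown N (by rw [he]; exact h.one_le N)
      have h2 := htail N
      rw [he] at h2
      linarith [h.eq_add N]
    have hpos : ∀ N, weight α (N + 1) < tail (weight α) x N → 1 ≤ x N := by
      intro N hN
      by_contra hc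
      have hx0 : x N = 0 := by omega
      have h1 := hup N (by rw [hx0]; exact h.one_le N)
      have h2 := htail N
      rw [hx0, Nat.cast_zero, zero_mul, zero_add] at h2
      linarith
    have hltA : ∀ N, x N < A N := by
      intro N
      induction N with
      | zero => exact hlt 0 (by rw [hxt, h0]; exact ht.2)
      | succ N ih => exact hlt _ (hup N ih)
    have hex : ∃ K, 1 ≤ x K := by
      by_contra! hc
      have : tail (weight α) x 0 = 0 := by
        simp [tail, fun n => Nat.lt_one_iff.1 (hc n)]
      exact ht.1.ne (this.symm.trans hxt)
    classical
    refine ⟨Nat.find hex, x, ⟨fun n hn => ?_, hltA, fun n hn => ?_⟩, hxt⟩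
    · have := Nat.find_min hex hn
      omega
    · induction n, hn using Nat.le_induction with
      | base => exact Nat.find_spec hex
      | succ n _ ih => exact hpos _ (hdown n ih)
  · rintro ⟨K, x, hx, rfl⟩
    have hxA : ∀ n, x n ≤ A n := fun n => (hx.2.1 n).le
    refine ⟨⟨?_, ?_⟩, x, (hexp _ _).2 ⟨hxA, rfl⟩, fun y hy => ?_⟩
    · have h1 := h.lt_tail_of_one_le h0 hxA hx.2.2
      have h2 : tail (weight α) x K ≤ tail (weight α) x 0 := by
        have : ∀ N, tail (weight α) x N ≤ tail (weight α) x 0 := by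
          intro N
          induction N with
          | zero => rfl
          | succ N ih =>
            have h3 := h.tail_eq h0 hxA N
            have h4 : 0 ≤ (x N : ℝ) * weight α (N + 1) :=
              mul_nonneg (Nat.cast_nonneg _) (h.pos _).le
            linarith
        exact this K
      linarith [h.pos (K + 1)]
    · exact (h.tail_lt_of_lt h0 hx.2.1 0).trans_eq h0
    · obtain ⟨hy, hyt⟩ := (hexp _ _).1 hy
      exact h.eq_of_tail_eq h0 hx hy hyt

namespace IsWeight

open MeasureTheory ENNReal NNReal

variable {A : ℕ → ℕ} {b : ℕ → ℝ} {K C : ℕ}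

/-- The number of cylinders of length `n` needed to cover the interior digit sequences. -/
theorem prod_max_le (h : IsWeight A b) (hC : ∀ n, A n ≤ C) (n : ℕ) :
    ∏ k ∈ Finset.range n, max 1 (A k - 1) ≤
      C ^ ((Finset.range n).filter fun k => A k ≠ 2).card := by
  rw [← Finset.prod_const, Finset.prod_filter]
  refine Finset.prod_le_prod' fun k _ => ?_
  have h1 := h.one_le k
  have h2 := hC k
  split_ifs with h3
  · exact max_le (by omega) (by omega)
  · have : A k = 2 := not_not.1 h3
    simp [this]

theorem pow_mul_rpow_le (h : IsWeight A b) (h0 : b 0 = 1) {s : ℝ} (hs : 0 ≤ s) {m n : ℕ}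
    (hm : (C : ℝ) * m ≤ s / 2 * n) : (C : ℝ) ^ m * b n ^ s ≤ 4 ^ (s / 2) := by
  have h1 : (C : ℝ) ^ m ≤ 2 ^ (s / 2 * n) := by
    calc (C : ℝ) ^ m ≤ (2 ^ C) ^ m := by gcongr; exact_mod_cast C.lt_two_pow_self.le
      _ = 2 ^ ((C : ℝ) * m) := by rw [← pow_mul, ← Real.rpow_natCast, Nat.cast_mul]
      _ ≤ _ := Real.rpow_le_rpow_of_exponent_le one_le_two hm
  have h2 : b n ^ s ≤ 4 ^ (s / 2) * (2 ^ (s / 2 * n))⁻¹ := by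
    calc b n ^ s = (b n ^ 2) ^ (s / 2) := by
          rw [← Real.rpow_natCast, ← Real.rpow_mul (h.pos n).le]; congr 1; push_cast; ring
      _ ≤ (4 * (1 / 2) ^ n) ^ (s / 2) :=
          Real.rpow_le_rpow (sq_nonneg _) (h.sq_le h0 n) (by positivity)
      _ = _ := by
          rw [Real.mul_rpow (by norm_num) (by positivity), one_div, inv_pow,
            Real.inv_rpow (by positivity), ← Real.rpow_natCast, ← Real.rpow_mul (by norm_num),
            mul_comm (n : ℝ)]
  have h3 : (0 : ℝ) < 2 ^ (s / 2 * n) := by positivity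
  calc (C : ℝ) ^ m * b n ^ s ≤ 2 ^ (s / 2 * n) * (4 ^ (s / 2) * (2 ^ (s / 2 * n))⁻¹) :=
        mul_le_mul h1 h2 (Real.rpow_nonneg (h.pos n).le _) h3.le
    _ = _ := by field_simp

theorem dimH_interior_eq_zero (h : IsWeight A b) (h0 : b 0 = 1) (hC : ∀ n, A n ≤ C)
    (hfreq : ∀ ε : ℝ, 0 < ε →
      ∃ᶠ n : ℕ in atTop, (((Finset.range n).filter fun k => A k ≠ 2).card : ℝ) ≤ ε * n) :
    dimH ((fun x => tail b x 0) '' interiorDigits A K) = 0 := by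
  by_contra hne
  obtain ⟨s, hs0, hs⟩ := ENNReal.lt_iff_exists_nnreal_btwn.1 (pos_iff_ne_zero.2 hne)
  have hs0 : (0 : ℝ) < s := by exact_mod_cast hs0
  have hCpos : (0 : ℝ) < C := by exact_mod_cast (h.one_le 0).trans (hC 0)
  have htop := hausdorffMeasure_of_lt_dimH hs
  let S : Set ℕ := {n | (((Finset.range n).filter fun k => A k ≠ 2).card : ℝ) ≤ s / (2 * C) * n}
  have hneBot : NeBot (atTop ⊓ 𝓟 S) :=
    frequently_mem_iff_neBot.1 (hfreq (s / (2 * C)) (by positivity))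
  let T : ∀ n : ℕ, (∀ k : Fin n, Fin (max 1 (A k - 1))) → Set ℝ := fun n i =>
    (fun x => tail b x 0) '' {x | x ∈ interiorDigits A K ∧ ∀ k : Fin n, x k - 1 = i k}
  have hdiam : ∀ n i, Metric.ediam (T n i) ≤ ENNReal.ofReal (b n) := by
    intro n i
    refine Metric.ediam_le ?_
    rintro _ ⟨x, ⟨hx, hxi⟩, rfl⟩ _ ⟨y, ⟨hy, hyi⟩, rfl⟩
    rw [edist_dist, Real.dist_eq]
    refine ENNReal.ofReal_le_ofReal ?_
    rw [h.tail_sub_of_eq h0 (fun n => (hx.2.1 n).le) (fun n => (hy.2.1 n).le) (N := n), abs_le]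
    · have := h.tail_lt_of_lt h0 hx.2.1 n
      have := h.tail_lt_of_lt h0 hy.2.1 n
      have := h.tail_nonneg (x := x) n
      have := h.tail_nonneg (x := y) n
      constructor <;> linarith
    · intro k hk
      have h1 := (hxi ⟨k, hk⟩).trans (hyi ⟨k, hk⟩).symm
      simp only at h1
      rcases lt_or_ge k K with hkK | hkK
      · rw [hx.1 k hkK, hy.1 k hkK]
      · have := hx.2.2 k hkK
        have := hy.2.2 k hkK
        omega
  have hcover : ∀ n, (fun x => tail b x 0) '' interiorDigits A K ⊆ ⋃ i, T n i := by
    rintro n _ ⟨x, hx, rfl⟩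
    refine mem_iUnion.2 ⟨fun k => ⟨x k - 1, ?_⟩, x, ⟨hx, fun k => rfl⟩, rfl⟩
    have := hx.2.1 k
    omega
  have hle := Measure.hausdorffMeasure_le_liminf_sum (l := atTop ⊓ 𝓟 S) (s : ℝ)
    ((fun x => tail b x 0) '' interiorDigits A K) (fun n => ENNReal.ofReal (b n))
    (by simpa using (ENNReal.tendsto_ofReal (h.tendsto_zero h0)).mono_left inf_le_left) T
    (Eventually.of_forall hdiam) (Eventually.of_forall hcover)
  rw [htop, top_le_iff] at hle
  refine ENNReal.ofReal_ne_top (r := 4 ^ ((s : ℝ) / 2)) (top_le_iff.1 (hle.symm.trans_le ?_))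
  refine (liminf_le_liminf (v := fun _ => ENNReal.ofReal (4 ^ ((s : ℝ) / 2))) ?_).trans
    (liminf_const _).le
  filter_upwards [mem_inf_of_right (mem_principal_self S)] with n hn
  have hm : (C : ℝ) * ((Finset.range n).filter fun k => A k ≠ 2).card ≤ s / 2 * n := by
    have h1 : (((Finset.range n).filter fun k => A k ≠ 2).card : ℝ) ≤ s / (2 * C) * n := hn
    calc _ ≤ (C : ℝ) * (s / (2 * C) * n) := by gcongr
      _ = _ := by field_simp
  calc ∑ i, Metric.ediam (T n i) ^ (s : ℝ)
      ≤ ∑ _i : ∀ k : Fin n, Fin (max 1 (A k - 1)), ENNReal.ofReal (b n) ^ (s : ℝ) :=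
        Finset.sum_le_sum fun i _ => ENNReal.rpow_le_rpow (hdiam n i) hs0.le
    _ = ((∏ k ∈ Finset.range n, max 1 (A k - 1) : ℕ) : ℝ≥0∞) * ENNReal.ofReal (b n ^ (s : ℝ)) := by
        rw [Finset.sum_const, nsmul_eq_mul, Finset.card_univ, Fintype.card_pi,
          ENNReal.ofReal_rpow_of_pos (h.pos n)]
        simp only [Fintype.card_fin]
        rw [Fin.prod_univ_eq_prod_range (fun k => max 1 (A k - 1)) n]
    _ ≤ ((C ^ ((Finset.range n).filter fun k => A k ≠ 2).card : ℕ) : ℝ≥0∞) *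
          ENNReal.ofReal (b n ^ (s : ℝ)) := by
        gcongr
        exact h.prod_max_le hC n
    _ = ENNReal.ofReal ((C : ℝ) ^ ((Finset.range n).filter fun k => A k ≠ 2).card *
          b n ^ (s : ℝ)) := by
        rw [ENNReal.ofReal_mul (by positivity), ← Nat.cast_pow, ENNReal.ofReal_natCast]
    _ ≤ _ := ENNReal.ofReal_le_ofReal (h.pow_mul_rpow_le h0 hs0.le hm)

end IsWeight

section Encode

variable {A : ℕ → ℕ} {b : ℕ → ℝ} {K C : ℕ}

/-- The places from `K` on at which an interior digit sequence has a choice. -/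
abbrev IsFree (A : ℕ → ℕ) (K k : ℕ) : Prop := K ≤ k ∧ 3 ≤ A k

/-- The interior digit sequence with the binary digits of `y` at the free places. -/
noncomputable def encode (A : ℕ → ℕ) (K : ℕ) (y : ℝ) (k : ℕ) : ℕ :=
  if k < K then 0 else if 3 ≤ A k then 1 + (Real.digits y 2 (Nat.count (IsFree A K) k) : ℕ) else 1

theorem encode_mem (h : IsWeight A b) (hK : ∀ n, K ≤ n → 2 ≤ A n) (y : ℝ) :
    encode A K y ∈ interiorDigits A K := by
  refine ⟨fun n hn => if_pos hn, fun n => ?_, fun n hn => ?_⟩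
  · have h1 := h.one_le n
    have h2 := hK n
    have h3 := (Real.digits y 2 (Nat.count (IsFree A K) n)).isLt
    unfold encode
    split_ifs <;> omega
  · unfold encode
    split_ifs <;> omega

theorem digits_eq_of_encode_eq {y z : ℝ} {n : ℕ} (hn : ∀ k < n, encode A K y k = encode A K z k) :
    ∀ i < Nat.count (IsFree A K) n, Real.digits y 2 i = Real.digits z 2 i := by
  induction n with
  | zero => simp
  | succ n ih =>
    intro i hi
    have ih := ih fun k hk => hn k (hk.trans n.lt_succ_self)
    rw [Nat.count_succ] at hi
    split_ifs at hi with hf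
    · rcases Nat.lt_succ_iff_lt_or_eq.1 hi with hi | rfl
      · exact ih i hi
      · have h1 := hn n n.lt_succ_self
        simp only [encode, if_neg (not_lt.2 hf.1), if_pos hf.2] at h1
        exact Fin.ext (by omega)
    · exact ih i hi

/-- The value of `encode y` determines `y` in a Hölder continuous way. -/
theorem abs_sub_le_of_encode (h : IsWeight A b) (h0 : b 0 = 1) (hC : ∀ n, A n ≤ C)
    (hK : ∀ n, K ≤ n → 2 ≤ A n) {δ M r : ℝ} (hδ : 0 < δ)
    (hM : ∀ n : ℕ, δ * n - M ≤ Nat.count (IsFree A K) n) (hr0 : 0 ≤ r)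
    (hr : (C + 1 : ℝ) ^ r = 2 ^ δ) {y z : ℝ} (hy : y ∈ Ico (0 : ℝ) 1) (hz : z ∈ Ico (0 : ℝ) 1) :
    |y - z| ≤ 2 ^ (M + 2 * δ) * |tail b (encode A K y) 0 - tail b (encode A K z) 0| ^ r := by
  by_cases hex : ∃ n, encode A K y n ≠ encode A K z n
  · classical
    obtain ⟨n, hne, hmin⟩ : ∃ n, encode A K y n ≠ encode A K z n ∧
        ∀ k < n, encode A K y k = encode A K z k :=
      ⟨Nat.find hex, Nat.find_spec hex, fun k hk => not_not.1 (Nat.find_min hex hk)⟩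
    have h1 : |y - z| ≤ ((2 : ℝ) ^ Nat.count (IsFree A K) n)⁻¹ := by
      have := Real.abs_ofDigits_sub_ofDigits_le (digits_eq_of_encode_eq hmin)
      rwa [Real.ofDigits_digits one_lt_two hy, Real.ofDigits_digits one_lt_two hz,
        Nat.cast_ofNat] at this
    have h2 : ((2 : ℝ) ^ Nat.count (IsFree A K) n)⁻¹ ≤ 2 ^ (M - δ * n) := by
      rw [← Real.rpow_natCast, ← Real.rpow_neg zero_le_two]
      exact Real.rpow_le_rpow_of_exponent_le one_le_two (by linarith [hM n])
    have h3 : ((C + 1 : ℝ) ^ (n + 2))⁻¹ ≤ |tail b (encode A K y) 0 - tail b (encode A K z) 0| :=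
      (h.inv_pow_le h0 hC (n + 2)).trans
        (h.lt_abs_tail_sub h0 (encode_mem h hK y) (encode_mem h hK z) hmin hne).le
    have h4 : (((C + 1 : ℝ) ^ (n + 2))⁻¹) ^ r = 2 ^ (-(δ * (n + 2))) := by
      rw [Real.inv_rpow (by positivity), ← Real.rpow_natCast, ← Real.rpow_mul (by positivity),
        mul_comm, Real.rpow_mul (by positivity), hr, ← Real.rpow_mul zero_le_two,
        ← Real.rpow_neg zero_le_two]
      push_cast
      rfl
    calc |y - z| ≤ 2 ^ (M - δ * n) := h1.trans h2
      _ = 2 ^ (M + 2 * δ) * 2 ^ (-(δ * (n + 2))) := by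
        rw [← Real.rpow_add zero_lt_two]; congr 1; ring
      _ ≤ _ := by
        rw [← h4]
        gcongr
  · push Not at hex
    have hd : Real.digits y 2 = Real.digits z 2 := by
      ext1 i
      obtain ⟨n, hn⟩ := exists_nat_gt ((M + i) / δ)
      rw [div_lt_iff₀ hδ] at hn
      refine digits_eq_of_encode_eq (n := n) (fun k _ => hex k) i ?_
      have := hM n
      exact_mod_cast (show (i : ℝ) < Nat.count (IsFree A K) n by linarith)
    have : y = z := by
      rw [← Real.ofDigits_digits one_lt_two hy, hd, Real.ofDigits_digits one_lt_two hz]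
    rw [this, sub_self, abs_zero]
    positivity

theorem dimH_interior_pos (h : IsWeight A b) (h0 : b 0 = 1) (hC : ∀ n, A n ≤ C)
    (hK : ∀ n, K ≤ n → 2 ≤ A n) {δ M : ℝ} (hδ : 0 < δ)
    (hM : ∀ n : ℕ, δ * n - M ≤ Nat.count (IsFree A K) n) :
    0 < dimH ((fun x => tail b x 0) '' interiorDigits A K) := by
  have hC1 : (1 : ℝ) ≤ C := by exact_mod_cast (h.one_le 0).trans (hC 0)
  have hlog : 0 < Real.log (C + 1) := Real.log_pos (by linarith)
  have hlog2 : 0 < Real.log 2 := Real.log_pos one_lt_two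
  obtain ⟨r, hr⟩ : ∃ r : NNReal, (r : ℝ) = δ * Real.log 2 / Real.log (C + 1) :=
    ⟨⟨_, by positivity⟩, rfl⟩
  have hr0 : 0 < r := by
    rw [← NNReal.coe_pos, hr]
    positivity
  have hrpow : (C + 1 : ℝ) ^ (r : ℝ) = 2 ^ δ := by
    rw [Real.rpow_def_of_pos (by linarith), Real.rpow_def_of_pos two_pos, hr]
    congr 1
    field_simp
  obtain ⟨c, hc⟩ : ∃ c : NNReal, (c : ℝ) = 2 ^ (M + 2 * δ) := ⟨⟨_, by positivity⟩, rfl⟩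
  let g : ℝ → ℝ := fun y => tail b (encode A K y) 0
  have hg : ∀ y ∈ Ico (0 : ℝ) 1, ∀ z ∈ Ico (0 : ℝ) 1, |y - z| ≤ c * |g y - g z| ^ (r : ℝ) := by
    intro y hy z hz
    rw [hc]
    exact abs_sub_le_of_encode h h0 hC hK hδ hM r.2 hrpow hy hz
  have hinj : InjOn g (Ico 0 1) := by
    intro y hy z hz hyz
    have := hg y hy z hz
    rw [hyz, sub_self, abs_zero, Real.zero_rpow (NNReal.coe_pos.2 hr0).ne', mul_zero] at this
    exact sub_eq_zero.1 (abs_nonpos_iff.1 this)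
  have hinv := hinj.leftInvOn_invFunOn
  have hholder : HolderOnWith c r (Function.invFunOn g (Ico 0 1)) (g '' Ico 0 1) := by
    rintro _ ⟨y, hy, rfl⟩ _ ⟨z, hz, rfl⟩
    rw [hinv hy, hinv hz, edist_dist, edist_dist, Real.dist_eq, Real.dist_eq,
      ENNReal.ofReal_rpow_of_nonneg (abs_nonneg _) r.coe_nonneg, ← ENNReal.ofReal_coe_nnreal,
      ← ENNReal.ofReal_mul c.coe_nonneg]
    exact ENNReal.ofReal_le_ofReal (hg y hy z hz)
  have hdim := hholder.dimH_image_le hr0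
  rw [hinv.image_image, Real.dimH_of_nonempty_interior (by simp)] at hdim
  have hsub : g '' Ico 0 1 ⊆ (fun x => tail b x 0) '' interiorDigits A K := by
    rintro _ ⟨y, _, rfl⟩
    exact ⟨_, encode_mem h hK y, rfl⟩
  refine lt_of_lt_of_le (pos_iff_ne_zero.2 fun hzero => ?_) (dimH_mono hsub)
  rw [hzero] at hdim
  simp at hdim

end Encode

section Frequency

variable {α : ℝ}

theorem twoFrequency_mul (n : ℕ) : twoFrequency α n * n +
    ((Finset.range n).filter fun k => partialQuotient α (k + 1) ≠ 2).card = n := by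
  have h1 : ((Finset.Icc 1 n).filter fun k => partialQuotient α k = 2).card =
      ((Finset.range n).filter fun k => partialQuotient α (k + 1) = 2).card := by
    rw [Finset.card_filter, Finset.card_filter, ← Finset.Ico_succ_right_eq_Icc,
      Finset.sum_Ico_eq_sum_range]
    simp [add_comm 1]
  have h2 : (((Finset.range n).filter fun k => partialQuotient α (k + 1) = 2).card : ℝ) +
      ((Finset.range n).filter fun k => partialQuotient α (k + 1) ≠ 2).card = n := by
    exact_mod_cast (Finset.card_filter_add_card_filter_not _).trans (Finset.card_range n)
  rcases n.eq_zero_or_pos with rfl | hn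
  · simp
  · rw [twoFrequency, div_mul_cancel₀ _ (by positivity), h1, h2]

theorem twoFrequency_nonneg (n : ℕ) : 0 ≤ twoFrequency α n := by
  unfold twoFrequency
  positivity

theorem twoFrequency_le_one (n : ℕ) : twoFrequency α n ≤ 1 := by
  rcases n.eq_zero_or_pos with rfl | hn
  · simp [twoFrequency]
  · have h1 := twoFrequency_mul (α := α) n
    have hn' : (0 : ℝ) < n := by exact_mod_cast hn
    by_contra! hc
    nlinarith [Nat.cast_nonneg (α := ℝ)
      ((Finset.range n).filter fun k => partialQuotient α (k + 1) ≠ 2).card]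

theorem isBoundedUnder_twoFrequency : IsBoundedUnder (· ≤ ·) atTop (twoFrequency α) :=
  isBoundedUnder_of ⟨1, twoFrequency_le_one⟩

theorem isCoboundedUnder_twoFrequency : IsCoboundedUnder (· ≤ ·) atTop (twoFrequency α) :=
  (isBoundedUnder_of ⟨0, twoFrequency_nonneg⟩ :
    IsBoundedUnder (· ≥ ·) atTop (twoFrequency α)).isCoboundedUnder_le

theorem frequently_card_le (hlim : 1 ≤ limsup (twoFrequency α) atTop) {ε : ℝ} (hε : 0 < ε) :
    ∃ᶠ n : ℕ in atTop,
      (((Finset.range n).filter fun k => partialQuotient α (k + 1) ≠ 2).card : ℝ) ≤ ε * n := by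
  refine (frequently_lt_of_lt_limsup isCoboundedUnder_twoFrequency
    (show 1 - ε < limsup (twoFrequency α) atTop by linarith)).mono fun n hn => ?_
  have h1 := twoFrequency_mul (α := α) n
  nlinarith [Nat.cast_nonneg (α := ℝ) n]

theorem exists_le_count (hlim : limsup (twoFrequency α) atTop < 1) {K : ℕ}
    (hK : ∀ n, K ≤ n → 2 ≤ partialQuotient α (n + 1)) :
    ∃ δ M : ℝ, 0 < δ ∧ ∀ n : ℕ,
      δ * n - M ≤ Nat.count (IsFree (fun n => partialQuotient α (n + 1)) K) n := by
  obtain ⟨c, hc, hc1⟩ := exists_between hlim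
  obtain ⟨N, hN⟩ := eventually_atTop.1
    (eventually_lt_of_limsup_lt hc isBoundedUnder_twoFrequency)
  refine ⟨1 - c, K + (1 - c) * N, by linarith, fun n => ?_⟩
  have hn0 : (0 : ℝ) ≤ n := n.cast_nonneg
  rcases le_total N n with hn | hn
  · have h1 := twoFrequency_mul (α := α) n
    have h2 : ((Finset.range n).filter fun k => partialQuotient α (k + 1) ≠ 2).card ≤
        K + Nat.count (IsFree (fun n => partialQuotient α (n + 1)) K) n := by
      rw [Nat.count_eq_card_filter_range]
      refine (Finset.card_le_card (t := Finset.range K ∪ (Finset.range n).filter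
        (IsFree (fun n => partialQuotient α (n + 1)) K)) fun k hk => ?_).trans
        ((Finset.card_union_le _ _).trans_eq (by rw [Finset.card_range]))
      simp only [Finset.mem_filter, Finset.mem_union, Finset.mem_range] at hk ⊢
      rcases lt_or_ge k K with h | h
      · exact Or.inl h
      · exact Or.inr ⟨hk.1, h, (hK k h).lt_of_ne' hk.2⟩
    have h3 : (((Finset.range n).filter fun k => partialQuotient α (k + 1) ≠ 2).card : ℝ) ≤
        K + Nat.count (IsFree (fun n => partialQuotient α (n + 1)) K) n := by exact_mod_cast h2
    have h4 := hN n hn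
    have h5 : (0 : ℝ) ≤ N := N.cast_nonneg
    nlinarith
  · have h1 : (n : ℝ) ≤ N := by exact_mod_cast hn
    have h2 : (0 : ℝ) ≤ K := K.cast_nonneg
    have h3 : (0 : ℝ) ≤ Nat.count (IsFree (fun n => partialQuotient α (n + 1)) K) n :=
      Nat.cast_nonneg _
    nlinarith

theorem exists_forall_ne_one (hn₀ : lastOne α < ⊤) :
    ∃ K, ∀ n, K ≤ n → partialQuotient α (n + 1) ≠ 1 := by
  obtain ⟨L, hL⟩ := ENat.ne_top_iff_exists.1 hn₀.ne
  refine ⟨L, fun n hn h1 => ?_⟩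
  have h2 : ((n + 1 : ℕ) : ℕ∞) ≤ lastOne α :=
    le_iSup₂ (f := fun (n : ℕ) (_ : n ∈ {n : ℕ | 1 ≤ n ∧ partialQuotient α n = 1}) => (n : ℕ∞))
      (n + 1) ⟨Nat.le_add_left _ _, h1⟩
  rw [← hL, Nat.cast_le] at h2
  omega

end Frequency

end RotationalExpansion

theorem mainTheorem7 (α : ℝ) (hα : α ∈ Ioo (0 : ℝ) 1) (hirr : Irrational α)
    (C : ℕ) (hC : ∀ n : ℕ, 1 ≤ n → RotationalExpansion.partialQuotient α n ≤ C)
    (hn₀ : RotationalExpansion.lastOne α < ⊤) :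
    0 < dimH (RotationalExpansion.uniqueSet α) ↔
      limsup (RotationalExpansion.twoFrequency α) atTop < 1 := by
  have h := RotationalExpansion.isWeight_weight hα hirr
  have h0 : RotationalExpansion.weight α 0 = 1 := by simp [RotationalExpansion.weight]
  have hC' : ∀ n, RotationalExpansion.partialQuotient α (n + 1) ≤ C :=
    fun n => hC _ (Nat.le_add_left _ _)
  have hV : RotationalExpansion.uniqueSet α = ⋃ K,
      (fun x => RotationalExpansion.tail (RotationalExpansion.weight α) x 0) ''
        RotationalExpansion.interiorDigits
          (fun n => RotationalExpansion.partialQuotient α (n + 1)) K := by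
    ext t
    simp only [RotationalExpansion.mem_uniqueSet_iff hα hirr, mem_iUnion, mem_image]
  constructor
  · contrapose!
    intro hlim
    rw [hV, dimH_iUnion]
    exact iSup_le fun K => (h.dimH_interior_eq_zero h0 hC'
      fun ε hε => RotationalExpansion.frequently_card_le hlim hε).le
  · intro hlim
    obtain ⟨K, hK⟩ := RotationalExpansion.exists_forall_ne_one hn₀
    have hK2 : ∀ n, K ≤ n → 2 ≤ RotationalExpansion.partialQuotient α (n + 1) := fun n hn =>
      lt_of_le_of_ne (h.one_le n) (hK n hn).symm
    obtain ⟨δ, M, hδ, hM⟩ := RotationalExpansion.exists_le_count hlim hK2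
    refine lt_of_lt_of_le (RotationalExpansion.dimH_interior_pos h h0 hC' hK2 hδ hM) ?_
    rw [hV]
    exact dimH_mono (subset_iUnion_of_subset K Subset.rfl)
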